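/- Let $p\ge 2$ be an integer. A rooted $(p,\infty)$-hypermap on $n$ darts is a triple $(\alpha,\sigma,r)$ on the set $D=\{1,\dots,n\}$ of darts, where $\alpha,\sigma$ are permutations of $D$ generating a group that acts transitively on $D$, all cycles of $\alpha$ have length exactly $p$ (i.e. all hyperedges are $p$-gons), and $r\in D$ is a marked dart (the root). Two of them, $(\alpha_1,\sigma_1,r_1)$ and $(\alpha_2,\sigma_2,r_2)$, are isomorphic if there is a permutation $\psi$ of $D$ with $\psi\alpha_1\psi^{-1}=\alpha_2$, $\psi\sigma_1\psi^{-1}=\sigma_2$ and $\psi(r_1)=r_2$. Let $h_p(n)$ be the number of isomorphism classes of rooted $(p,\infty)$-hypermaps on $n$ darts (so $h_p(0)=0$), and let $H^\circ(z)=\sum_{n\ge 0}h_p(n)z^n$, a formal power series. Then: (i) $H^\circ(z)$ is transcendental, i.e. not algebraic over $\mathbb{C}(z)$. (ii) As formal power series, $H^\circ(z)=p\,x\,\dfrac{f'(x)}{f(x)}$ with $x=p^{p-1}z^p$, where $$f(x)={}_pF_0\!\left[\tfrac1p,\dots,\tfrac{p-1}p,1;\,x\right]=\sum_{k\ge0}\frac{\left(\tfrac1p\right)_k\left(\tfrac2p\right)_k\cdots\left(\tfrac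 pp\right)_k}{k!}\,x^k,\qquad (a)_k=a(a+1)\cdots(a+k-1).$$ (iii) The coefficient $h_p(n)$ is non-zero exactly when $n\geq 1$ and $p\mid n$, and, as $k\to\infty$, $$h_p(pk)\;\sim\;\frac{(2\pi)^{\frac{p-1}{2}}\,p}{\prod_{i=1}^{p}\Gamma\!\left(\frac ip\right)}\;k^{(p-1)k+1}\;e^{(p-1)(\log p-1)k},$$ where $\sim$ means that the ratio of the two sides tends to $1$. -/

import Mathlib

open scoped Asymptotics

/-- A rooted connected oriented `(p,∞)`-hypermap on the dart set `Fin n`: two permutations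
`α` (whose cycles are the hyperedges) and `σ` (whose cycles are the vertices) generating a
transitive group, such that every cycle of `α` (fixed points being cycles of length one) has
length `p`, together with a marked dart. -/
structure RootedHypermap (p n : ℕ) where
  α : Equiv.Perm (Fin n)
  σ : Equiv.Perm (Fin n)
  root : Fin n
  transitive : MulAction.IsPretransitive
    (Subgroup.closure ({α, σ} : Set (Equiv.Perm (Fin n)))) (Fin n)
  cycles : ∀ c ∈ α.partition.parts, c = p

namespace RootedHypermap

/-- Isomorphism of rooted hypermaps: a relabelling of the darts that conjugates the two
permutations of the first into those of the second and sends root to root. -/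
def Iso {p n : ℕ} (H₁ H₂ : RootedHypermap p n) : Prop :=
  ∃ ψ : Equiv.Perm (Fin n),
    ψ * H₁.α * ψ⁻¹ = H₂.α ∧ ψ * H₁.σ * ψ⁻¹ = H₂.σ ∧ ψ H₁.root = H₂.root

theorem iso_equivalence (p n : ℕ) : Equivalence (Iso (p := p) (n := n)) where
  refl H := ⟨1, by simp, by simp, by simp⟩
  symm := by
    rintro H₁ H₂ ⟨ψ, hα, hσ, hr⟩
    refine ⟨ψ⁻¹, ?_, ?_, ?_⟩
    · rw [← hα]; group
    · rw [← hσ]; group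
    · rw [← hr]; simp
  trans := by
    rintro H₁ H₂ H₃ ⟨ψ, hα, hσ, hr⟩ ⟨χ, hα', hσ', hr'⟩
    refine ⟨χ * ψ, ?_, ?_, ?_⟩
    · rw [← hα', ← hα]; group
    · rw [← hσ', ← hσ]; group
    · rw [← hr', ← hr]; rfl

instance setoid (p n : ℕ) : Setoid (RootedHypermap p n) := ⟨Iso, iso_equivalence p n⟩

instance finite (p n : ℕ) : Finite (RootedHypermap p n) :=
  Finite.of_injective
    (fun H => ((H.α, H.σ, H.root) : Equiv.Perm (Fin n) × Equiv.Perm (Fin n) × Fin n)) (by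
      rintro ⟨α, σ, r, _, _⟩ ⟨α', σ', r', _, _⟩ h
      simp only [Prod.mk.injEq] at h
      obtain ⟨rfl, rfl, rfl⟩ := h
      rfl)

/-- The number of rooted connected `(p,∞)`-hypermaps on `n` darts, up to isomorphism. -/
noncomputable def count (p n : ℕ) : ℕ := Nat.card (Quotient (setoid p n))

/-- The ordinary generating series `∑ₙ count p n * zⁿ`. -/
noncomputable def series (p : ℕ) : PowerSeries ℂ := PowerSeries.mk fun n => (count p n : ℂ)

end RootedHypermap

/-- The formal hypergeometric series `ᵣFₛ(a; b; x)`, whose coefficient of `xᵏ` is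
`∏ᵢ (aᵢ)ₖ / ((∏ⱼ (bⱼ)ₖ) * k!)`, with `(a)ₖ` the rising factorial. -/
noncomputable def hypergeometricPowerSeries {r s : ℕ} (a : Fin r → ℂ) (b : Fin s → ℂ) :
    PowerSeries ℂ :=
  PowerSeries.mk fun k =>
    (∏ i, (ascPochhammer ℂ k).eval (a i)) /
      ((∏ j, (ascPochhammer ℂ k).eval (b j)) * (k.factorial : ℂ))

/-!
Write `c(n)` for the number of permutations of `n` points all of whose cycles have length `p`. It
vanishes unless `n = p * k`, and `c(p * k) = (p * k)! / (p ^ k * k!)` (`card_allCyclesOfLength_mul`).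

*Recursion.* Take an arbitrary triple `(α, σ, r)` on `n` darts with all cycles of `α` of length `p`,
and let `S` be the component of `r`. The triple amounts to a connected triple on `S` together with
an arbitrary pair on the complement (`card_triplesWithComponent`). Rooted hypermaps have no
automorphisms, so there are `h(m) * m!` connected triples on `m` labelled darts, where `h` counts
isomorphism classes. Summing over `S` and dividing by `n!` gives
`n * c(n) = ∑ m ≤ n, h(m) * c(n - m)` (`RootedHypermap.mul_permCount_eq_sum`). In terms of
`F = ∑ c(n) zⁿ` this says `H * F = z * F'`, and the product formula for the rising factorials
`(i / p)ₖ` identifies `F` with `f(p ^ (p - 1) * z ^ p)`, and the chain rule gives the formula.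

*Asymptotics.* Since `c(p * j) * c(p * (k - j)) ≤ c(p * k) / k.choose j`, the terms of the recursion
with `0 < m < n` are negligible, so that `h(p * k) ∼ p * k * c(p * k)`
(`RootedHypermap.mul_permCount_sub_count_le`). The hypergeometric form of `c(p * k)` is then
estimated by Euler's limit formula for `Γ`, applied to each `(i / p)ₖ`, and Stirling's formula.

*Transcendence.* By the asymptotics `h(p * k) ≥ k!` for large `k`, so `H` diverges, whereas a power
series algebraic over `ℂ[z]` has a positive radius of convergence. For the latter, let `P` be a
polynomial of minimal degree with `P(H) = 0`, so that `∂P(H) ≠ 0`. If `H` agrees with a polynomial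
`T` up to the order of vanishing of `∂P(H)`, the Taylor expansion of `P` at `T` turns `P(H) = 0`
into an equation `w = c + z * G(z, w)` for the remainder `w`, with polynomials `c` and `G`. Weighted
`ℓ¹` norms of the truncations of `w` are then bounded by induction on the degree of truncation.
-/

/-! ### Components and cycle lengths -/

section Components

open Equiv

/-- Every cycle of `α`, fixed points included, has length `p`. -/
def AllCyclesOfLength {D : Type*} (p : ℕ) (α : Perm D) : Prop :=
  ∀ (x : D) (k : ℕ), (α ^ k) x = x ↔ p ∣ k

/-- The set of darts in the connected component of `r`, described as the intersection of all
sets of darts that contain `r` and are preserved by `α` and `σ`. -/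
def dartComponent {D : Type*} (α σ : Perm D) (r : D) : Set D :=
  {y | ∀ T : Set D, (∀ x, α x ∈ T ↔ x ∈ T) → (∀ x, σ x ∈ T ↔ x ∈ T) → r ∈ T → y ∈ T}

section Component

variable {D : Type*} {α σ : Perm D} {r : D}

theorem mem_dartComponent_self : r ∈ dartComponent α σ r := fun _ _ _ h => h

theorem left_mem_dartComponent_iff (x : D) :
    α x ∈ dartComponent α σ r ↔ x ∈ dartComponent α σ r :=
  ⟨fun h T hα hσ hr => (hα x).1 (h T hα hσ hr), fun h T hα hσ hr => (hα x).2 (h T hα hσ hr)⟩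

theorem right_mem_dartComponent_iff (x : D) :
    σ x ∈ dartComponent α σ r ↔ x ∈ dartComponent α σ r :=
  ⟨fun h T hα hσ hr => (hσ x).1 (h T hα hσ hr), fun h T hα hσ hr => (hσ x).2 (h T hα hσ hr)⟩

theorem isPretransitive_closure_iff_dartComponent_eq_univ (α σ : Perm D) (r : D) :
    MulAction.IsPretransitive (Subgroup.closure ({α, σ} : Set (Perm D))) D ↔
      dartComponent α σ r = Set.univ := by
  constructor
  · intro h
    refine Set.eq_univ_of_forall fun y T hα hσ hr => ?_
    obtain ⟨⟨g, hg⟩, rfl⟩ := MulAction.exists_smul_eq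
      (Subgroup.closure ({α, σ} : Set (Perm D))) r y
    have key : ∀ x, g x ∈ T ↔ x ∈ T := by
      induction hg using Subgroup.closure_induction with
      | mem g hg => rcases hg with rfl | rfl <;> assumption
      | one => simp
      | mul f g _ _ hf hg => intro x; rw [Perm.mul_apply, hf, hg]
      | inv g _ hg => intro x; rw [← hg (g⁻¹ x)]; simp
    exact (key r).2 hr
  · intro h
    set G := Subgroup.closure ({α, σ} : Set (Perm D))
    have key : ∀ (g : G) (x : D), g • x ∈ MulAction.orbit G r ↔ x ∈ MulAction.orbit G r :=
      fun g x => ⟨fun h => by simpa using MulAction.mem_orbit_of_mem_orbit g⁻¹ h,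
        MulAction.mem_orbit_of_mem_orbit g⟩
    have horb : ∀ y, y ∈ MulAction.orbit G r := by
      intro y
      have hy : y ∈ dartComponent α σ r := h ▸ Set.mem_univ y
      refine hy _ (fun x => ?_) (fun x => ?_) (MulAction.mem_orbit_self r)
      · exact key (⟨α, Subgroup.subset_closure (by simp)⟩ : G) x
      · exact key (⟨σ, Subgroup.subset_closure (by simp)⟩ : G) x
    refine ⟨fun x y => ?_⟩
    obtain ⟨g, rfl⟩ := horb x
    obtain ⟨k, rfl⟩ := horb y
    exact ⟨k * g⁻¹, by simp [mul_smul]⟩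

end Component

section CycleLength

variable {D : Type*} [Fintype D] [DecidableEq D]

theorem pow_apply_eq_self_iff_orderOf_cycleOf_dvd (α : Perm D) (x : D) (k : ℕ) :
    (α ^ k) x = x ↔ orderOf (α.cycleOf x) ∣ k := by
  rw [← Perm.cycleOf_pow_apply_self, orderOf_dvd_iff_pow_eq_one]
  by_cases hx : α x = x
  · simp [(Perm.cycleOf_eq_one_iff α).2 hx]
  · exact ((Perm.isCycle_cycleOf α hx).pow_eq_one_iff' (by simpa using hx)).symm

theorem mem_parts_partition_iff_exists_orderOf_cycleOf (α : Perm D) (c : ℕ) :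
    c ∈ α.partition.parts ↔ ∃ x, orderOf (α.cycleOf x) = c := by
  rw [Perm.parts_partition, Multiset.mem_add]
  constructor
  · rintro (h | h)
    · rw [Perm.cycleType_def, Multiset.mem_map] at h
      obtain ⟨f, hf, rfl⟩ := h
      have hf' := (Perm.mem_cycleFactorsFinset_iff.1 hf).1
      obtain ⟨x, hx⟩ := hf'.nonempty_support
      refine ⟨x, ?_⟩
      rw [← Perm.cycle_is_cycleOf hx hf, hf'.orderOf]; rfl
    · obtain ⟨h0, rfl⟩ := Multiset.mem_replicate.1 h
      have hlt : α.support.card < Fintype.card D := by omega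
      obtain ⟨x, -, hx⟩ := Finset.exists_mem_notMem_of_card_lt_card
        (s := α.support) (t := Finset.univ) (by simpa using hlt)
      refine ⟨x, ?_⟩
      rw [(Perm.cycleOf_eq_one_iff α).2 (Perm.notMem_support.1 hx), orderOf_one]
  · rintro ⟨x, rfl⟩
    by_cases hx : α x = x
    · right
      rw [(Perm.cycleOf_eq_one_iff α).2 hx, orderOf_one, Multiset.mem_replicate]
      have hlt : α.support.card < Fintype.card D := by
        rw [← Finset.card_univ]
        exact Finset.card_lt_card ((Finset.ssubset_iff_of_subset (Finset.subset_univ _)).2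
          ⟨x, Finset.mem_univ _, Perm.notMem_support.2 hx⟩)
      exact ⟨by omega, rfl⟩
    · left
      rw [Perm.cycleType_def, Multiset.mem_map]
      refine ⟨α.cycleOf x, ?_, ((Perm.isCycle_cycleOf α hx).orderOf).symm⟩
      exact Perm.cycleOf_mem_cycleFactorsFinset_iff.2 (Perm.mem_support.2 hx)

theorem forall_mem_parts_partition_eq_iff {p : ℕ} (α : Perm D) :
    (∀ c ∈ α.partition.parts, c = p) ↔ AllCyclesOfLength p α := by
  simp only [mem_parts_partition_iff_exists_orderOf_cycleOf, AllCyclesOfLength,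
    pow_apply_eq_self_iff_orderOf_cycleOf_dvd]
  constructor
  · intro h x k
    rw [h _ ⟨x, rfl⟩]
  · rintro h _ ⟨x, rfl⟩
    exact Nat.dvd_antisymm ((h x p).2 dvd_rfl) ((h x _).1 dvd_rfl)

/-- All cycles of `α` have length `p ≥ 2` exactly when the nontrivial ones do and there are enough
of them to cover all points. -/
theorem allCyclesOfLength_iff_cycleType_eq {p k : ℕ} (hp : 2 ≤ p) (hD : Fintype.card D = p * k)
    (α : Perm D) : AllCyclesOfLength p α ↔ α.cycleType = Multiset.replicate k p := by
  rw [← forall_mem_parts_partition_eq_iff]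
  constructor
  · intro h
    have h1 := Multiset.eq_replicate_card.2 h
    have h2 := α.partition.parts_sum
    rw [h1, Multiset.sum_replicate, smul_eq_mul, mul_comm] at h2
    have h3 := Nat.eq_of_mul_eq_mul_left (by omega) (h2.trans hD)
    rw [← Perm.filter_parts_partition_eq_cycleType, Multiset.filter_eq_self.2, h1, h3]
    intro a ha
    rw [h a ha]; exact hp
  · intro h c hc
    have hs : α.support.card = p * k := by
      rw [← Perm.sum_cycleType, h, Multiset.sum_replicate, smul_eq_mul, mul_comm]
    rw [Perm.parts_partition, hs, hD, Nat.sub_self, h] at hc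
    simp only [Multiset.replicate_zero, add_zero] at hc
    exact Multiset.eq_of_mem_replicate hc

theorem AllCyclesOfLength.dvd_card {p : ℕ} {α : Perm D} (h : AllCyclesOfLength p α) :
    p ∣ Fintype.card D := by
  rw [← forall_mem_parts_partition_eq_iff] at h
  rw [← α.partition.parts_sum, Multiset.eq_replicate_card.2 h, Multiset.sum_replicate]
  exact Dvd.intro_left _ rfl

theorem card_allCyclesOfLength_mul {p k : ℕ} (hp : 2 ≤ p) (hD : Fintype.card D = p * k) :
    Nat.card {α : Perm D // AllCyclesOfLength p α} * (p ^ k * k.factorial) =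
      (p * k).factorial := by
  have h := Perm.card_of_cycleType_mul_eq (α := D) (Multiset.replicate k p)
  rw [if_pos ⟨by rw [Multiset.sum_replicate, hD, smul_eq_mul, mul_comm],
    fun a ha => by rw [Multiset.eq_of_mem_replicate ha]; exact hp⟩, hD] at h
  have h2 : ∏ n ∈ (Multiset.replicate k p).toFinset, ((Multiset.replicate k p).count n).factorial
      = k.factorial := by
    rcases Nat.eq_zero_or_pos k with rfl | hk
    · simp
    · rw [Multiset.toFinset_replicate, if_neg (by omega)]; simp
  rw [h2, Multiset.prod_replicate, Multiset.sum_replicate, smul_eq_mul, mul_comm k p, Nat.sub_self,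
    Nat.factorial_zero, one_mul] at h
  rw [← h]
  congr 1
  simp only [allCyclesOfLength_iff_cycleType_eq hp hD]
  rw [Nat.card_eq_fintype_card, Fintype.card_subtype]

end CycleLength

section Gluing

variable {D : Type*} (S : Set D) [DecidablePred (· ∈ S)]

theorem allCyclesOfLength_subtypeCongr_iff {p : ℕ} (a : Perm {x // x ∈ S})
    (b : Perm {x // ¬ x ∈ S}) :
    AllCyclesOfLength p (Perm.subtypeCongr a b) ↔ AllCyclesOfLength p a ∧ AllCyclesOfLength p b := by
  have hpow : ∀ k : ℕ, (Perm.subtypeCongr a b) ^ k = Perm.subtypeCongr (a ^ k) (b ^ k) :=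
    fun k => (map_pow (Perm.subtypeCongrHom (· ∈ S)) (a, b) k).symm
  constructor
  · intro h
    refine ⟨fun x k => ?_, fun x k => ?_⟩
    · rw [← h x k, hpow, Perm.subtypeCongr.left_apply_subtype, Subtype.ext_iff]
    · rw [← h x k, hpow, Perm.subtypeCongr.right_apply_subtype, Subtype.ext_iff]
  · rintro ⟨h1, h2⟩ x k
    rw [hpow]
    by_cases hx : x ∈ S
    · rw [Perm.subtypeCongr.left_apply _ _ hx, ← h1 ⟨x, hx⟩ k, Subtype.ext_iff]
    · rw [Perm.subtypeCongr.right_apply _ _ hx, ← h2 ⟨x, hx⟩ k, Subtype.ext_iff]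

theorem dartComponent_subtypeCongr (a s : Perm {x // x ∈ S}) (b t : Perm {x // ¬ x ∈ S})
    (r : {x // x ∈ S}) :
    dartComponent (Perm.subtypeCongr a b) (Perm.subtypeCongr s t) (r : D) =
      Subtype.val '' dartComponent a s r := by
  have key : ∀ (f : Perm {x // x ∈ S}) (g : Perm {x // ¬ x ∈ S}) (U : Set {x // x ∈ S}),
      (∀ x, f x ∈ U ↔ x ∈ U) → ∀ x : D,
      Perm.subtypeCongr f g x ∈ Subtype.val '' U ↔ x ∈ Subtype.val '' U := by
    intro f g U hU x
    by_cases hx : x ∈ S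
    · rw [Perm.subtypeCongr.left_apply _ _ hx]
      simpa [hx] using hU ⟨x, hx⟩
    · rw [Perm.subtypeCongr.right_apply _ _ hx]
      have h1 : ∀ y : {x // ¬ x ∈ S}, (y : D) ∉ Subtype.val '' U := by
        rintro y ⟨z, -, hz⟩
        exact y.2 (hz ▸ z.2)
      exact iff_of_false (h1 _) (h1 ⟨x, hx⟩)
  apply Set.Subset.antisymm
  · intro y hy
    exact hy _ (key a b _ left_mem_dartComponent_iff) (key s t _ right_mem_dartComponent_iff)
      ⟨r, mem_dartComponent_self, rfl⟩
  · rintro _ ⟨y, hy, rfl⟩ T hα hσ hr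
    refine hy (Subtype.val ⁻¹' T) (fun x => ?_) (fun x => ?_) hr
    · simpa using hα x
    · simpa using hσ x

end Gluing

end Components

/-! ### Counting triples by the component of the root -/

section Triples

open Equiv

/-- Triples `(α, σ, r)` on `D` in which all cycles of `α` have length `p` and whose component
at `r` is `S`. For `S = Set.univ` these are the labelled rooted hypermaps. -/
abbrev TriplesWithComponent (p : ℕ) (D : Type) (S : Set D) : Type :=
  {t : Perm D × Perm D × D // AllCyclesOfLength p t.1 ∧ dartComponent t.1 t.2.1 t.2.2 = S}

section Counting

variable {D E : Type}

theorem allCyclesOfLength_permCongr_iff {p : ℕ} (e : D ≃ E) (α : Perm D) :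
    AllCyclesOfLength p (e.permCongr α) ↔ AllCyclesOfLength p α := by
  have hpow : ∀ k : ℕ, (e.permCongr α) ^ k = e.permCongr (α ^ k) :=
    fun k => (map_pow e.permCongrHom α k).symm
  constructor
  · intro h x k
    rw [← h (e x) k, hpow]; simp
  · intro h x k
    rw [← h (e.symm x) k, hpow, e.permCongr_apply, e.eq_symm_apply]

theorem dartComponent_permCongr (e : D ≃ E) (α σ : Perm D) (r : D) :
    dartComponent (e.permCongr α) (e.permCongr σ) (e r) = e '' dartComponent α σ r := by
  have key : ∀ (f : Perm D) (U : Set D), (∀ x, f x ∈ U ↔ x ∈ U) →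
      ∀ y, e.permCongr f y ∈ e '' U ↔ y ∈ e '' U := by
    intro f U hU y
    obtain ⟨x, rfl⟩ := e.surjective y
    simpa using hU x
  apply Set.Subset.antisymm
  · intro y hy
    exact hy _ (key _ _ left_mem_dartComponent_iff) (key _ _ right_mem_dartComponent_iff)
      ⟨r, mem_dartComponent_self, rfl⟩
  · rintro _ ⟨y, hy, rfl⟩ T hα hσ hr
    refine hy (e ⁻¹' T) (fun x => ?_) (fun x => ?_) hr
    · simpa using hα (e x)
    · simpa using hσ (e x)

theorem card_allCyclesOfLength_congr (p : ℕ) (e : D ≃ E) :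
    Nat.card {α : Perm D // AllCyclesOfLength p α} =
      Nat.card {α : Perm E // AllCyclesOfLength p α} :=
  Nat.card_congr (e.permCongr.subtypeEquiv fun α => (allCyclesOfLength_permCongr_iff e α).symm)

theorem card_triplesWithComponent_univ_congr (p : ℕ) (e : D ≃ E) :
    Nat.card (TriplesWithComponent p D Set.univ) =
      Nat.card (TriplesWithComponent p E Set.univ) := by
  refine Nat.card_congr ((e.permCongr.prodCongr (e.permCongr.prodCongr e)).subtypeEquiv ?_)
  rintro ⟨α, σ, r⟩
  simp only [prodCongr_apply, Prod.map_apply, allCyclesOfLength_permCongr_iff,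
    dartComponent_permCongr]
  rw [← Set.image_univ_of_surjective e.surjective, e.injective.image_injective.eq_iff]

/-- A triple whose component at the root is `S` amounts to a connected triple on `S` together with
an arbitrary pair of permutations of the complement. -/
theorem card_triplesWithComponent (p : ℕ) (S : Set D) :
    Nat.card (TriplesWithComponent p D S) =
      Nat.card (TriplesWithComponent p {x // x ∈ S} Set.univ) *
        (Nat.card {α : Perm {x // ¬ x ∈ S} // AllCyclesOfLength p α} *
          Nat.card (Perm {x // ¬ x ∈ S})) := by
  classical
  rw [← Nat.card_prod, ← Nat.card_prod]
  symm
  let glue : TriplesWithComponent p {x // x ∈ S} Set.univ ×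
      ({α : Perm {x // ¬ x ∈ S} // AllCyclesOfLength p α} × Perm {x // ¬ x ∈ S}) →
      TriplesWithComponent p D S := fun t =>
    ⟨(Perm.subtypeCongr t.1.1.1 t.2.1.1, Perm.subtypeCongr t.1.1.2.1 t.2.2, t.1.1.2.2.1),
      (allCyclesOfLength_subtypeCongr_iff S _ _).2 ⟨t.1.2.1, t.2.1.2⟩, by
        rw [dartComponent_subtypeCongr, t.1.2.2]; simp⟩
  refine Nat.card_congr (Equiv.ofBijective glue ⟨?_, ?_⟩)
  · rintro ⟨⟨⟨a, s, r⟩, h⟩, ⟨b, hb⟩, t⟩ ⟨⟨⟨a', s', r'⟩, h'⟩, ⟨b', hb'⟩, t'⟩ heq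
    simp only [glue, Subtype.mk.injEq, Prod.mk.injEq] at heq
    have h1 := Perm.subtypeCongrHom_injective (· ∈ S) (a₁ := (a, b)) (a₂ := (a', b')) heq.1
    have h2 := Perm.subtypeCongrHom_injective (· ∈ S) (a₁ := (s, t)) (a₂ := (s', t')) heq.2.1
    have h3 := Subtype.ext heq.2.2
    simp only [Prod.mk.injEq] at h1 h2
    obtain ⟨rfl, rfl⟩ := h1
    obtain ⟨rfl, rfl⟩ := h2
    subst h3
    rfl
  · rintro ⟨⟨α, σ, r⟩, hα, hS⟩
    simp only at hα hS
    have hαS : ∀ x, α x ∈ S ↔ x ∈ S := fun x => by rw [← hS]; exact left_mem_dartComponent_iff x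
    have hσS : ∀ x, σ x ∈ S ↔ x ∈ S := fun x => by rw [← hS]; exact right_mem_dartComponent_iff x
    have hr : r ∈ S := by rw [← hS]; exact mem_dartComponent_self
    have split : ∀ (f : Perm D) (hf : ∀ x, f x ∈ S ↔ x ∈ S),
        Perm.subtypeCongr (f.subtypePerm hf) (f.subtypePerm fun x => not_congr (hf x)) = f := by
      intro f hf
      ext x
      rw [Perm.subtypeCongr.apply]
      split_ifs <;> rfl
    have hα' := hα
    rw [← split α hαS, allCyclesOfLength_subtypeCongr_iff] at hα'
    have hS' := hS
    rw [← split α hαS, ← split σ hσS,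
      dartComponent_subtypeCongr S _ _ _ _ (⟨r, hr⟩ : {x // x ∈ S})] at hS'
    refine ⟨⟨⟨(α.subtypePerm hαS, σ.subtypePerm hσS, ⟨r, hr⟩), hα'.1, ?_⟩,
      ⟨α.subtypePerm fun x => not_congr (hαS x), hα'.2⟩,
      σ.subtypePerm fun x => not_congr (hσS x)⟩, ?_⟩
    · refine Set.eq_univ_of_forall fun y => ?_
      obtain ⟨z, hz, hzy⟩ : (y : D) ∈ Subtype.val '' _ := by rw [hS']; exact y.2
      rwa [← Subtype.ext hzy]
    · apply Subtype.ext
      simp only [glue, split]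

end Counting

namespace RootedHypermap

variable {p n : ℕ}

theorem eq_iff_components {H₁ H₂ : RootedHypermap p n} :
    H₁ = H₂ ↔ H₁.α = H₂.α ∧ H₁.σ = H₂.σ ∧ H₁.root = H₂.root := by
  cases H₁; cases H₂; simp

/-- The symmetric group acts on rooted hypermaps by relabelling the darts; the orbits are the
isomorphism classes. -/
instance : MulAction (Perm (Fin n)) (RootedHypermap p n) where
  smul ψ H :=
    { α := ψ * H.α * ψ⁻¹
      σ := ψ * H.σ * ψ⁻¹
      root := ψ H.root
      transitive := by
        have h := H.transitive
        rw [isPretransitive_closure_iff_dartComponent_eq_univ _ _ H.root] at h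
        rw [isPretransitive_closure_iff_dartComponent_eq_univ _ _ (ψ H.root)]
        have h' := dartComponent_permCongr ψ H.α H.σ H.root
        rw [h, Set.image_univ_of_surjective ψ.surjective] at h'
        exact h'
      cycles := by
        rw [forall_mem_parts_partition_eq_iff]
        exact (allCyclesOfLength_permCongr_iff ψ H.α).2
          ((forall_mem_parts_partition_eq_iff _).1 H.cycles) }
  one_smul H := eq_iff_components.2
    ⟨show 1 * H.α * 1⁻¹ = H.α by simp, show 1 * H.σ * 1⁻¹ = H.σ by simp, rfl⟩
  mul_smul ψ χ H := eq_iff_components.2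
    ⟨show (ψ * χ) * H.α * (ψ * χ)⁻¹ = ψ * (χ * H.α * χ⁻¹) * ψ⁻¹ by group,
      show (ψ * χ) * H.σ * (ψ * χ)⁻¹ = ψ * (χ * H.σ * χ⁻¹) * ψ⁻¹ by group, rfl⟩

theorem smul_eq_iff {ψ : Perm (Fin n)} {H₁ H₂ : RootedHypermap p n} :
    ψ • H₁ = H₂ ↔
      ψ * H₁.α * ψ⁻¹ = H₂.α ∧ ψ * H₁.σ * ψ⁻¹ = H₂.σ ∧ ψ H₁.root = H₂.root :=
  eq_iff_components

/-- Rooted hypermaps have no nontrivial automorphisms: the fixed points of an automorphism are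
preserved by `α` and `σ` and contain the root, so they are all the darts. -/
theorem stabilizer_eq_bot (H : RootedHypermap p n) :
    MulAction.stabilizer (Perm (Fin n)) H = ⊥ := by
  rw [eq_bot_iff]
  intro ψ hψ
  obtain ⟨hα, hσ, hr⟩ := smul_eq_iff.1 (MulAction.mem_stabilizer_iff.1 hψ)
  rw [mul_inv_eq_iff_eq_mul] at hα hσ
  have h := (isPretransitive_closure_iff_dartComponent_eq_univ _ _ H.root).1 H.transitive
  have key : ∀ f : Perm (Fin n), ψ * f = f * ψ → ∀ x, f x ∈ {x | ψ x = x} ↔ x ∈ {x | ψ x = x} := by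
    intro f hf x
    have := congrArg (fun g : Perm (Fin n) => g x) hf
    simp only [Perm.mul_apply] at this
    simp [this]
  rw [Subgroup.mem_bot]
  ext x
  have hx : x ∈ dartComponent H.α H.σ H.root := h ▸ Set.mem_univ x
  have hx' : x ∈ {x | ψ x = x} := hx _ (key _ hα) (key _ hσ) hr
  exact congrArg Fin.val hx'

theorem card_eq_count_mul_factorial :
    Nat.card (RootedHypermap p n) = count p n * n.factorial := by
  rw [Nat.card_congr (MulAction.selfEquivOrbitsQuotientProd (G := Perm (Fin n)) stabilizer_eq_bot),
    Nat.card_prod, Nat.card_perm, Nat.card_fin, count]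
  congr 1
  refine Nat.card_congr (Quotient.congr (Equiv.refl _) fun H₁ H₂ => ?_)
  rw [MulAction.orbitRel_apply]
  refine ⟨fun ⟨ψ, hψ⟩ => (iso_equivalence p n).symm ⟨ψ, smul_eq_iff.1 hψ⟩, fun h => ?_⟩
  obtain ⟨ψ, hψ⟩ := (iso_equivalence p n).symm h
  exact ⟨ψ, smul_eq_iff.2 hψ⟩

theorem card_triplesWithComponent_univ :
    Nat.card (TriplesWithComponent p (Fin n) Set.univ) = count p n * n.factorial := by
  rw [← card_eq_count_mul_factorial]
  refine Nat.card_congr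
    { toFun := fun t => ⟨t.1.1, t.1.2.1, t.1.2.2,
        (isPretransitive_closure_iff_dartComponent_eq_univ _ _ _).2 t.2.2,
        (forall_mem_parts_partition_eq_iff _).2 t.2.1⟩
      invFun := fun H => ⟨(H.α, H.σ, H.root), (forall_mem_parts_partition_eq_iff _).1 H.cycles,
        (isPretransitive_closure_iff_dartComponent_eq_univ _ _ _).1 H.transitive⟩
      left_inv := fun _ => rfl
      right_inv := fun _ => rfl }

/-- The number of permutations of `n` points all of whose cycles have length `p`. -/
noncomputable def permCount (p n : ℕ) : ℕ :=
  Nat.card {α : Perm (Fin n) // AllCyclesOfLength p α}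

theorem card_triplesWithComponent_fin (S : Finset (Fin n)) :
    Nat.card (TriplesWithComponent p (Fin n) S) =
      count p S.card * S.card.factorial *
        (permCount p (n - S.card) * (n - S.card).factorial) := by
  classical
  have e₁ : {x // x ∈ (S : Set (Fin n))} ≃ Fin S.card := Fintype.equivFinOfCardEq (by simp)
  have e₂ : {x // ¬ x ∈ (S : Set (Fin n))} ≃ Fin (n - S.card) :=
    Fintype.equivFinOfCardEq (by simp [Fintype.card_subtype_compl])
  rw [card_triplesWithComponent, card_triplesWithComponent_univ_congr p e₁,
    card_allCyclesOfLength_congr p e₂, Nat.card_congr e₂.permCongr, Nat.card_perm, Nat.card_fin,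
    card_triplesWithComponent_univ]
  rfl

/-- Every triple `(α, σ, r)` has exactly one component at `r`. -/
theorem sum_card_triplesWithComponent :
    ∑ S : Finset (Fin n), Nat.card (TriplesWithComponent p (Fin n) S) =
      permCount p n * (n.factorial * n) := by
  classical
  have h1 : permCount p n * (n.factorial * n) =
      Nat.card {t : Perm (Fin n) × Perm (Fin n) × Fin n // AllCyclesOfLength p t.1} := by
    rw [permCount]
    have h2 : Nat.card (Perm (Fin n) × Fin n) = n.factorial * n := by
      rw [Nat.card_prod, Nat.card_perm, Nat.card_fin]
    rw [← h2, ← Nat.card_prod]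
    exact Nat.card_congr (Equiv.prodSubtypeFstEquivSubtypeProd (p := AllCyclesOfLength p)).symm
  rw [h1, ← Nat.card_sigma]
  refine Nat.card_congr
    { toFun := fun t => ⟨t.2.1, t.2.2.1⟩
      invFun := fun t => ⟨(dartComponent t.1.1 t.1.2.1 t.1.2.2).toFinset, t.1, t.2, by simp⟩
      left_inv := ?_
      right_inv := fun _ => rfl }
  rintro ⟨S, t, ht, hS⟩
  obtain rfl : (dartComponent t.1 t.2.1 t.2.2).toFinset = S := by simp [hS]
  rfl

/-- The recursion obtained by splitting off the component of the root. -/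
theorem mul_permCount_eq_sum (p n : ℕ) :
    n * permCount p n = ∑ m ∈ Finset.range (n + 1), count p m * permCount p (n - m) := by
  have h := sum_card_triplesWithComponent (p := p) (n := n)
  simp only [card_triplesWithComponent_fin] at h
  rw [← Finset.powerset_univ, Finset.sum_powerset_apply_card (fun m => count p m * m.factorial *
        (permCount p (n - m) * (n - m).factorial))] at h
  apply Nat.eq_of_mul_eq_mul_left n.factorial_pos
  calc n.factorial * (n * permCount p n) = permCount p n * (n.factorial * n) := by ring
    _ = _ := h.symm
    _ = _ := by
      rw [Finset.card_univ, Fintype.card_fin, Finset.mul_sum]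
      refine Finset.sum_congr rfl fun m hm => ?_
      rw [← Nat.choose_mul_factorial_mul_factorial (Nat.lt_succ_iff.1 (Finset.mem_range.1 hm)),
        smul_eq_mul]
      ring

theorem count_zero (p : ℕ) : count p 0 = 0 := by
  have h := card_eq_count_mul_factorial (p := p) (n := 0)
  have : IsEmpty (RootedHypermap p 0) := ⟨fun H => H.root.elim0⟩
  simpa using h.symm

theorem permCount_mul {p : ℕ} (hp : 2 ≤ p) (k : ℕ) :
    permCount p (p * k) * (p ^ k * k.factorial) = (p * k).factorial :=
  card_allCyclesOfLength_mul hp (Fintype.card_fin _)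

theorem permCount_of_not_dvd (h : ¬ p ∣ n) : permCount p n = 0 := by
  have : IsEmpty {α : Perm (Fin n) // AllCyclesOfLength p α} :=
    ⟨fun α => h (by simpa using α.2.dvd_card)⟩
  exact Nat.card_of_isEmpty

theorem count_ne_zero_iff_nonempty : count p n ≠ 0 ↔ Nonempty (RootedHypermap p n) := by
  rw [count, ← Nat.pos_iff_ne_zero, Nat.card_pos_iff]
  constructor
  · rintro ⟨⟨q⟩, -⟩
    exact ⟨q.out⟩
  · rintro ⟨H⟩
    exact ⟨⟨Quotient.mk _ H⟩, inferInstance⟩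

/-- For existence take `σ` to be a single cycle through all darts. -/
theorem count_ne_zero_iff (hp : 2 ≤ p) (n : ℕ) : count p n ≠ 0 ↔ n ≠ 0 ∧ p ∣ n := by
  rw [count_ne_zero_iff_nonempty]
  constructor
  · rintro ⟨H⟩
    refine ⟨fun h => ?_, ?_⟩
    · subst h; exact H.root.elim0
    · simpa using ((forall_mem_parts_partition_eq_iff _).1 H.cycles).dvd_card
  · rintro ⟨hn, k, rfl⟩
    have hpos : 0 < permCount p (p * k) := by
      refine Nat.pos_of_ne_zero fun h => ?_
      have := permCount_mul hp k
      rw [h, zero_mul] at this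
      exact (p * k).factorial_ne_zero this.symm
    obtain ⟨⟨α, hα⟩⟩ := (Nat.card_pos_iff.1 hpos).1
    have : NeZero (p * k) := ⟨hn⟩
    refine ⟨⟨α, finRotate (p * k), 0, ?_, (forall_mem_parts_partition_eq_iff _).2 hα⟩⟩
    rw [isPretransitive_closure_iff_dartComponent_eq_univ _ _ 0]
    refine Set.eq_univ_of_forall fun y T _ hσ hr => ?_
    obtain ⟨m, hm⟩ := y
    induction m with
    | zero => exact hr
    | succ m ih =>
      have h1 := (hσ ⟨m, by omega⟩).2 (ih (by omega))
      convert h1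
      rw [finRotate_apply]
      simp [Fin.val_add, Nat.mod_eq_of_lt hm]

end RootedHypermap

end Triples

/-! ### Convergence of algebraic power series -/

namespace PowerSeries

/-- The weighted `ℓ¹` norm, with weights `rⁿ`, of the truncation of `f` at degree `N`. -/
noncomputable def truncNorm (N : ℕ) (r : ℝ) (f : PowerSeries ℂ) : ℝ :=
  ∑ n ∈ Finset.range (N + 1), ‖coeff n f‖ * r ^ n

variable {N : ℕ} {r : ℝ}

theorem truncNorm_nonneg (hr : 0 ≤ r) (f : PowerSeries ℂ) : 0 ≤ truncNorm N r f :=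
  Finset.sum_nonneg fun _ _ => by positivity

theorem truncNorm_add_le (hr : 0 ≤ r) (f g : PowerSeries ℂ) :
    truncNorm N r (f + g) ≤ truncNorm N r f + truncNorm N r g := by
  rw [truncNorm, truncNorm, truncNorm, ← Finset.sum_add_distrib]
  refine Finset.sum_le_sum fun n _ => ?_
  rw [← add_mul, map_add]
  exact mul_le_mul_of_nonneg_right (norm_add_le _ _) (by positivity)

theorem truncNorm_mul_le (hr : 0 ≤ r) (f g : PowerSeries ℂ) :
    truncNorm N r (f * g) ≤ truncNorm N r f * truncNorm N r g := by
  have h1 : ∀ n, ‖coeff n (f * g)‖ * r ^ n ≤ ∑ x ∈ Finset.HasAntidiagonal.antidiagonal n,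
      (‖coeff x.1 f‖ * r ^ x.1) * (‖coeff x.2 g‖ * r ^ x.2) := by
    intro n
    rw [coeff_mul]
    calc ‖∑ x ∈ Finset.HasAntidiagonal.antidiagonal n, coeff x.1 f * coeff x.2 g‖ * r ^ n
        ≤ (∑ x ∈ Finset.HasAntidiagonal.antidiagonal n, ‖coeff x.1 f * coeff x.2 g‖) * r ^ n :=
          mul_le_mul_of_nonneg_right (norm_sum_le _ _) (by positivity)
      _ = _ := by
        rw [Finset.sum_mul]
        refine Finset.sum_congr rfl fun x hx => ?_
        rw [← Finset.HasAntidiagonal.mem_antidiagonal.1 hx, norm_mul, pow_add]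
        ring
  calc truncNorm N r (f * g)
      ≤ ∑ n ∈ Finset.range (N + 1), ∑ x ∈ Finset.HasAntidiagonal.antidiagonal n,
        (‖coeff x.1 f‖ * r ^ x.1) * (‖coeff x.2 g‖ * r ^ x.2) :=
        Finset.sum_le_sum fun n _ => h1 n
    _ = ∑ x ∈ (Finset.range (N + 1)).sigma Finset.HasAntidiagonal.antidiagonal,
        (‖coeff x.2.1 f‖ * r ^ x.2.1) * (‖coeff x.2.2 g‖ * r ^ x.2.2) :=
        Finset.sum_sigma' _ _ _
    _ = ∑ x ∈ ((Finset.range (N + 1)).sigma Finset.HasAntidiagonal.antidiagonal).image Sigma.snd,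
        (‖coeff x.1 f‖ * r ^ x.1) * (‖coeff x.2 g‖ * r ^ x.2) := by
        rw [Finset.sum_image]
        rintro ⟨n, x⟩ hx ⟨m, y⟩ hy rfl
        simp only [Finset.coe_sigma, Set.mem_sigma_iff, Finset.mem_coe,
          Finset.HasAntidiagonal.mem_antidiagonal] at hx hy
        obtain rfl : n = m := hx.2.symm.trans hy.2
        rfl
    _ ≤ ∑ x ∈ Finset.range (N + 1) ×ˢ Finset.range (N + 1),
        (‖coeff x.1 f‖ * r ^ x.1) * (‖coeff x.2 g‖ * r ^ x.2) := by
        refine Finset.sum_le_sum_of_subset_of_nonneg ?_ fun _ _ _ => by positivity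
        intro x hx
        obtain ⟨⟨n, y⟩, hy, rfl⟩ := Finset.mem_image.1 hx
        simp only [Finset.mem_sigma, Finset.mem_range, Finset.HasAntidiagonal.mem_antidiagonal] at hy
        simp only [Finset.mem_product, Finset.mem_range]
        omega
    _ = _ := by rw [Finset.sum_product, truncNorm, truncNorm, Finset.sum_mul_sum]

theorem truncNorm_succ_X_mul (f : PowerSeries ℂ) :
    truncNorm (N + 1) r (X * f) = r * truncNorm N r f := by
  rw [truncNorm, Finset.sum_range_succ', truncNorm, Finset.mul_sum]
  simp only [coeff_succ_X_mul, coeff_zero_X_mul, norm_zero, zero_mul, add_zero]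
  exact Finset.sum_congr rfl fun n _ => by ring

theorem exists_truncNorm_coe_le (q : Polynomial ℂ) :
    ∃ M : ℝ, ∀ (N : ℕ) (r : ℝ), 0 ≤ r → r ≤ 1 → truncNorm N r (q : PowerSeries ℂ) ≤ M := by
  refine ⟨∑ n ∈ Finset.range (q.natDegree + 1), ‖q.coeff n‖, fun N r h0 h1 => ?_⟩
  rw [truncNorm]
  calc ∑ n ∈ Finset.range (N + 1), ‖coeff n (q : PowerSeries ℂ)‖ * r ^ n
      ≤ ∑ n ∈ Finset.range (N + 1), ‖q.coeff n‖ := by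
        refine Finset.sum_le_sum fun n _ => ?_
        rw [Polynomial.coeff_coe]
        exact mul_le_of_le_one_right (norm_nonneg _) (pow_le_one₀ h0 h1)
    _ ≤ _ := by
        have hsub := Finset.subset_union_right (s₁ := Finset.range (N + 1))
          (s₂ := Finset.range (q.natDegree + 1))
        rw [Finset.sum_subset hsub fun n _ hn => by
          rw [q.coeff_eq_zero_of_natDegree_lt (by simpa using hn), norm_zero]]
        exact Finset.sum_le_sum_of_subset_of_nonneg Finset.subset_union_left
          fun _ _ _ => norm_nonneg _

/-- A polynomial with polynomial coefficients maps bounded sets of power series to bounded sets,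
uniformly in the truncation and the weight. -/
theorem exists_truncNorm_aeval_le (G : Polynomial (Polynomial ℂ)) (B : ℝ) :
    ∃ M : ℝ, ∀ (N : ℕ) (r : ℝ) (w : PowerSeries ℂ), 0 ≤ r → r ≤ 1 → truncNorm N r w ≤ B →
      truncNorm N r (Polynomial.aeval w G) ≤ M := by
  induction G using Polynomial.induction_on with
  | C a =>
    obtain ⟨M, hM⟩ := exists_truncNorm_coe_le a
    refine ⟨M, fun N r w h0 h1 _ => ?_⟩
    rw [Polynomial.aeval_C]
    exact hM N r h0 h1
  | add G₁ G₂ ih₁ ih₂ =>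
    obtain ⟨M₁, h₁⟩ := ih₁
    obtain ⟨M₂, h₂⟩ := ih₂
    refine ⟨M₁ + M₂, fun N r w h0 h1 hw => ?_⟩
    rw [map_add]
    exact (truncNorm_add_le h0 _ _).trans (add_le_add (h₁ N r w h0 h1 hw) (h₂ N r w h0 h1 hw))
  | monomial n a ih =>
    obtain ⟨M, hM⟩ := ih
    refine ⟨M * B, fun N r w h0 h1 hw => ?_⟩
    rw [pow_succ, ← mul_assoc, map_mul, Polynomial.aeval_X]
    have h := hM N r w h0 h1 hw
    exact (truncNorm_mul_le h0 _ _).trans (mul_le_mul h hw (truncNorm_nonneg h0 _)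
      ((truncNorm_nonneg h0 _).trans h))

/-- A solution of a fixed point equation `w = c + z G(z, w)` with polynomial data has positive
radius of convergence: for small `r` the bound `‖w‖ ≤ B` on a truncation reproduces itself one
degree higher. -/
theorem exists_truncNorm_le_of_fixedPoint (c : Polynomial ℂ) (G : Polynomial (Polynomial ℂ))
    (w : PowerSeries ℂ) (hw : w = (c : PowerSeries ℂ) + X * Polynomial.aeval w G) :
    ∃ r : ℝ, 0 < r ∧ r ≤ 1 ∧ ∃ B : ℝ, ∀ N, truncNorm N r w ≤ B := by
  obtain ⟨K, hK⟩ := exists_truncNorm_coe_le c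
  obtain ⟨M, hM⟩ := exists_truncNorm_aeval_le G (K + 1)
  have hM1 : 0 < |M| + 1 := by positivity
  have hr0 : 0 < (|M| + 1)⁻¹ := by positivity
  have hr1 : (|M| + 1)⁻¹ ≤ 1 := by
    exact inv_le_one_of_one_le₀ (by linarith [abs_nonneg M])
  refine ⟨(|M| + 1)⁻¹, hr0, hr1, K + 1, fun N => ?_⟩
  induction N with
  | zero =>
    have h0 : coeff 0 w = coeff 0 (c : PowerSeries ℂ) := by
      conv_lhs => rw [hw]
      simp
    have h := hK 0 _ hr0.le hr1
    simp only [truncNorm, zero_add, Finset.sum_range_one, h0] at h ⊢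
    linarith
  | succ N ih =>
    have h := hM N _ w hr0.le hr1 ih
    rw [hw]
    refine (truncNorm_add_le hr0.le _ _).trans (add_le_add (hK _ _ hr0.le hr1) ?_)
    rw [truncNorm_succ_X_mul, inv_mul_le_iff₀ hM1]
    linarith [le_abs_self M]

theorem algebraMap_polynomial_eq_coe (q : Polynomial ℂ) :
    algebraMap (Polynomial ℂ) (PowerSeries ℂ) q = q := rfl

/-- With `m` the order of vanishing of `∂P(H)` and `T` the truncation of `H` at degree `m`, the
substitution `H = T + z ^ (m + 1) * w` makes the linear term of `P` dominate, and dividing the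
equation `P(H) = 0` by `z ^ (2 * m + 1)` puts it in fixed point form. -/
theorem exists_fixedPoint_of_aeval_eq_zero {H : PowerSeries ℂ} {P : Polynomial (Polynomial ℂ)}
    (hP : Polynomial.aeval H P = 0) (hP' : Polynomial.aeval H (Polynomial.derivative P) ≠ 0) :
    ∃ (T c : Polynomial ℂ) (m : ℕ) (G : Polynomial (Polynomial ℂ)) (w : PowerSeries ℂ),
      H = (T : PowerSeries ℂ) + X ^ m * w ∧
        w = (c : PowerSeries ℂ) + X * Polynomial.aeval w G := by
  obtain ⟨m, hm, hlt⟩ : ∃ m, coeff m (Polynomial.aeval H (Polynomial.derivative P)) ≠ 0 ∧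
      ∀ i < m, coeff i (Polynomial.aeval H (Polynomial.derivative P)) = 0 := by
    classical
    have h := (exists_coeff_ne_zero_iff_ne_zero).2 hP'
    exact ⟨Nat.find h, Nat.find_spec h, fun i hi => not_not.1 (Nat.find_min h hi)⟩
  set T : Polynomial ℂ := trunc (m + 1) H with hT
  obtain ⟨w, hw⟩ : ∃ w, H - (T : PowerSeries ℂ) = X ^ (m + 1) * w := by
    change X ^ (m + 1) ∣ H - (T : PowerSeries ℂ)
    rw [X_pow_dvd_iff]
    intro i hi
    rw [map_sub, hT, coeff_coe_trunc_of_lt hi, sub_self]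
  -- Expand `P` at `T`. The linear coefficient agrees with `∂P(H)` up to degree `m`, hence is `X ^ m`
  -- times a polynomial `b` with `b(0) ≠ 0`.
  set A := Polynomial.taylor T P with hA
  have hA0 : A = Polynomial.C (A.coeff 0) + Polynomial.X * (Polynomial.C (A.coeff 1) +
      Polynomial.X * A.divX.divX) := by
    conv_lhs => rw [← Polynomial.X_mul_divX_add A, ← Polynomial.X_mul_divX_add A.divX,
      Polynomial.coeff_divX]
    ring
  have hzero : Polynomial.aeval (X ^ (m + 1) * w) A = 0 := by
    rw [hA, Polynomial.taylor_apply, Polynomial.aeval_comp, ← hP]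
    congr 1
    simp only [map_add, Polynomial.aeval_X, Polynomial.aeval_C, algebraMap_polynomial_eq_coe]
    rw [← hw]; simp
  have hA1 : ∀ i ≤ m, (A.coeff 1).coeff i =
      coeff i (Polynomial.aeval H (Polynomial.derivative P)) := by
    intro i hi
    have h1 : ((A.coeff 1 : Polynomial ℂ) : PowerSeries ℂ) =
        Polynomial.aeval (T : PowerSeries ℂ) (Polynomial.derivative P) := by
      rw [hA, Polynomial.taylor_coeff_one, ← algebraMap_polynomial_eq_coe,
        ← algebraMap_polynomial_eq_coe, Polynomial.aeval_algebraMap_apply]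
      rfl
    have h2 : X ^ (m + 1) ∣ Polynomial.aeval H (Polynomial.derivative P) -
        ((A.coeff 1 : Polynomial ℂ) : PowerSeries ℂ) := by
      rw [h1, Polynomial.aeval_def, Polynomial.aeval_def, ← Polynomial.eval_map,
        ← Polynomial.eval_map]
      exact (Dvd.intro _ hw.symm).trans (Polynomial.sub_dvd_eval_sub _ _ _)
    have h3 := X_pow_dvd_iff.1 h2 i (by omega)
    rw [map_sub, sub_eq_zero, Polynomial.coeff_coe] at h3
    exact h3.symm
  obtain ⟨b, hb⟩ : Polynomial.X ^ m ∣ A.coeff 1 := by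
    rw [Polynomial.X_pow_dvd_iff]
    intro i hi
    rw [hA1 i hi.le, hlt i hi]
  have hb0 : b.coeff 0 ≠ 0 := by
    have h := hA1 m le_rfl
    rw [hb, Polynomial.coeff_X_pow_mul', if_pos le_rfl, Nat.sub_self] at h
    rwa [h]
  have hbX : (b : PowerSeries ℂ) = C (b.coeff 0) + X * (b.divX : PowerSeries ℂ) := by
    conv_lhs => rw [← Polynomial.X_mul_divX_add b]
    rw [Polynomial.coe_add, Polynomial.coe_mul, Polynomial.coe_X, Polynomial.coe_C, add_comm]
  set K : PowerSeries ℂ := Polynomial.aeval (X ^ (m + 1) * w) A.divX.divX with hK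
  have heq : ((A.coeff 0 : Polynomial ℂ) : PowerSeries ℂ) = X ^ (2 * m + 1) *
      -(C (b.coeff 0) * w + X * ((b.divX : PowerSeries ℂ) * w + w ^ 2 * K)) := by
    rw [hA0] at hzero
    simp only [map_add, map_mul, Polynomial.aeval_X, Polynomial.aeval_C,
      algebraMap_polynomial_eq_coe, ← hK, hb, Polynomial.coe_pow,
      Polynomial.coe_X, hbX] at hzero
    linear_combination hzero
  obtain ⟨c, hc⟩ : Polynomial.X ^ (2 * m + 1) ∣ A.coeff 0 := by
    rw [Polynomial.X_pow_dvd_iff]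
    intro i hi
    rw [← Polynomial.coeff_coe, X_pow_dvd_iff.1 (Dvd.intro _ heq.symm) i hi]
  rw [hc, Polynomial.coe_mul, Polynomial.coe_pow, Polynomial.coe_X] at heq
  have heq' := mul_left_cancel₀ (pow_ne_zero _ X_ne_zero) heq
  have hinv : C (b.coeff 0)⁻¹ * C (b.coeff 0) = (1 : PowerSeries ℂ) := by
    rw [← map_mul, inv_mul_cancel₀ hb0, map_one]
  refine ⟨T, Polynomial.C (-(b.coeff 0)⁻¹) * c, m + 1,
    Polynomial.C (Polynomial.C (-(b.coeff 0)⁻¹)) * (Polynomial.C b.divX * Polynomial.X +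
      Polynomial.X ^ 2 *
        A.divX.divX.comp (Polynomial.C (Polynomial.X ^ (m + 1)) * Polynomial.X)), w, ?_, ?_⟩
  · rw [← hw]; ring
  · simp only [map_add, map_mul, map_pow, Polynomial.aeval_X, Polynomial.aeval_C,
      algebraMap_polynomial_eq_coe, Polynomial.aeval_comp, Polynomial.coe_mul,
      Polynomial.coe_X, Polynomial.coe_C, ← hK, heq',
      map_neg (C : ℂ →+* PowerSeries ℂ)]
    linear_combination (-w) * hinv

/-- An algebraic power series has a positive radius of convergence. -/
theorem exists_norm_coeff_mul_pow_le_of_isAlgebraic {H : PowerSeries ℂ}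
    (hH : IsAlgebraic (Polynomial ℂ) H) :
    ∃ r : ℝ, 0 < r ∧ ∃ B : ℝ, ∀ n, ‖coeff n H‖ * r ^ n ≤ B := by
  classical
  -- An annihilating polynomial of least degree has a derivative that does not annihilate `H`.
  have hex : ∃ d, ∃ P : Polynomial (Polynomial ℂ), P ≠ 0 ∧ Polynomial.aeval H P = 0 ∧
      P.natDegree = d := by
    obtain ⟨P, h0, h1⟩ := hH
    exact ⟨_, P, h0, h1, rfl⟩
  obtain ⟨P, hP0, hP, hd⟩ := Nat.find_spec hex
  have hdeg : P.natDegree ≠ 0 := by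
    intro h
    rw [Polynomial.eq_C_of_natDegree_eq_zero h, Polynomial.aeval_C,
      algebraMap_polynomial_eq_coe, Polynomial.coe_eq_zero_iff] at hP
    rw [Polynomial.eq_C_of_natDegree_eq_zero h, hP, Polynomial.C_0] at hP0
    exact hP0 rfl
  have hP' : Polynomial.aeval H (Polynomial.derivative P) ≠ 0 := by
    intro h
    refine Nat.find_min hex (m := (Polynomial.derivative P).natDegree) ?_
      ⟨_, fun h0 => hdeg (Polynomial.derivative_eq_zero.1 h0), h, rfl⟩
    rw [← hd]
    exact Polynomial.natDegree_derivative_lt hdeg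
  obtain ⟨T, c, m, G, w, hHw, hw⟩ := exists_fixedPoint_of_aeval_eq_zero hP hP'
  obtain ⟨r, hr0, hr1, B, hB⟩ := exists_truncNorm_le_of_fixedPoint c G w hw
  obtain ⟨M, hM⟩ := exists_truncNorm_aeval_le
    (Polynomial.C T + Polynomial.C (Polynomial.X ^ m) * Polynomial.X) B
  refine ⟨r, hr0, M, fun n => ?_⟩
  have h := hM n r w hr0.le hr1 (hB n)
  simp only [map_add, map_mul, Polynomial.aeval_X, Polynomial.aeval_C,
    algebraMap_polynomial_eq_coe, Polynomial.coe_pow, Polynomial.coe_X] at h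
  rw [← hHw] at h
  refine le_trans ?_ h
  exact Finset.single_le_sum (f := fun n => ‖coeff n H‖ * r ^ n)
    (fun _ _ => by positivity) (Finset.self_mem_range_succ n)

end PowerSeries

/-! ### The generating series -/

/-- The factors `i / p + j` with `1 ≤ i ≤ p` and `j < k` are the numbers `1, …, p * k` divided
by `p`. -/
theorem prod_ascPochhammer_eval_mul_pow {K : Type*} [Field K] [CharZero K] {p : ℕ} (hp : p ≠ 0)
    (k : ℕ) :
    (∏ i ∈ Finset.range p, (ascPochhammer K k).eval (((i : ℕ) + 1 : K) / (p : K))) *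
      (p : K) ^ (p * k) = ((p * k).factorial : K) := by
  have hpK : (p : K) ≠ 0 := Nat.cast_ne_zero.2 hp
  induction k with
  | zero => simp
  | succ k ih =>
    have h1 : (p * (k + 1)).factorial = (p * k).factorial *
        ∏ i ∈ Finset.range p, (p * k + 1 + i) := by
      rw [← Nat.ascFactorial_eq_prod_range, Nat.factorial_mul_ascFactorial, Nat.mul_succ]
    simp only [ascPochhammer_succ_eval]
    rw [Finset.prod_mul_distrib, h1, Nat.cast_mul, ← ih, Nat.mul_succ, pow_add]
    have h2 : (∏ i ∈ Finset.range p, (((i : ℕ) + 1 : K) / (p : K) + k)) * (p : K) ^ p =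
        ((∏ i ∈ Finset.range p, (p * k + 1 + i) : ℕ) : K) := by
      conv_lhs => rw [← Finset.card_range p, ← Finset.prod_const, Finset.card_range]
      rw [← Finset.prod_mul_distrib, Nat.cast_prod]
      refine Finset.prod_congr rfl fun i _ => ?_
      push_cast
      field_simp
      ring
    rw [← h2]
    ring

namespace RootedHypermap

open PowerSeries

variable {p : ℕ}

/-- The hypergeometric coefficients count permutations all of whose cycles have length `p`. -/
theorem prod_ascPochhammer_eval_div_factorial {K : Type*} [Field K] [CharZero K] (hp : 2 ≤ p)
    (k : ℕ) :
    ((p : K) ^ (p - 1)) ^ k * ((∏ i ∈ Finset.range p,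
      (ascPochhammer K k).eval (((i : ℕ) + 1 : K) / (p : K))) / (k.factorial : K)) =
      permCount p (p * k) := by
  have hpK : (p : K) ≠ 0 := Nat.cast_ne_zero.2 (by omega)
  have hk : (k.factorial : K) ≠ 0 := Nat.cast_ne_zero.2 k.factorial_ne_zero
  have h1 := prod_ascPochhammer_eval_mul_pow (K := K) (p := p) (by omega) k
  have h2 : (permCount p (p * k) : K) * ((p : K) ^ k * k.factorial) = (p * k).factorial := by
    exact_mod_cast permCount_mul hp k
  rw [← h1] at h2
  have h3 : (p : K) ^ (p * k) = ((p : K) ^ (p - 1)) ^ k * (p : K) ^ k := by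
    rw [← mul_pow, ← pow_succ, Nat.sub_add_cancel (by omega), pow_mul]
  rw [h3] at h2
  apply mul_right_cancel₀ (mul_ne_zero (pow_ne_zero k hpK) hk)
  rw [h2]
  field_simp

theorem coeff_subst_C_mul_X_pow (hp : p ≠ 0) (a : ℂ) (f : PowerSeries ℂ) (n : ℕ) :
    coeff n (PowerSeries.subst (C a * X ^ p : PowerSeries ℂ) f) =
      if p ∣ n then a ^ (n / p) * coeff (n / p) f else 0 := by
  have hs : HasSubst (C a * X ^ p : PowerSeries ℂ) :=
    HasSubst.of_constantCoeff_zero' (by simp [hp])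
  have hpow : ∀ d, coeff n ((C a * X ^ p : PowerSeries ℂ) ^ d) =
      if n = p * d then a ^ d else 0 := by
    intro d
    rw [mul_pow, ← pow_mul, ← map_pow, coeff_C_mul, coeff_X_pow]
    split_ifs <;> simp
  rw [coeff_subst' hs]
  simp only [hpow, smul_eq_mul]
  split_ifs with h
  · obtain ⟨k, rfl⟩ := h
    rw [Nat.mul_div_cancel_left _ (Nat.pos_of_ne_zero hp), finsum_eq_single _ k]
    · rw [if_pos rfl, mul_comm]
    · intro d hd
      rw [if_neg fun h => hd (Nat.eq_of_mul_eq_mul_left (Nat.pos_of_ne_zero hp) h).symm, mul_zero]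
  · rw [finsum_eq_zero_of_forall_eq_zero]
    intro d
    rw [if_neg fun hd => h ⟨d, hd⟩, mul_zero]

theorem subst_hypergeometricPowerSeries (hp : 2 ≤ p) :
    PowerSeries.subst (C ((p : ℂ) ^ (p - 1)) * X ^ p : PowerSeries ℂ)
      (hypergeometricPowerSeries (fun i : Fin p => ((i : ℕ) + 1 : ℂ) / (p : ℂ))
        (Fin.elim0 : Fin 0 → ℂ)) = PowerSeries.mk fun n => (permCount p n : ℂ) := by
  ext n
  rw [coeff_subst_C_mul_X_pow (by omega), coeff_mk]
  split_ifs with h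
  · obtain ⟨k, rfl⟩ := h
    rw [Nat.mul_div_cancel_left _ (by omega), hypergeometricPowerSeries, coeff_mk,
      ← prod_ascPochhammer_eval_div_factorial hp k, Finset.prod_range]
    simp
  · rw [permCount_of_not_dvd h, Nat.cast_zero]

theorem coeff_X_mul_derivative (f : PowerSeries ℂ) (n : ℕ) :
    coeff n (X * PowerSeries.derivative ℂ f) = n * coeff n f := by
  cases n with
  | zero => simp
  | succ n =>
    rw [coeff_succ_X_mul, coeff_derivative, mul_comm]
    push_cast
    rfl

/-- `mul_permCount_eq_sum` as an identity of generating series. -/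
theorem series_mul_mk_permCount (p : ℕ) :
    series p * PowerSeries.mk (fun n => (permCount p n : ℂ)) =
      X * PowerSeries.derivative ℂ (PowerSeries.mk fun n => (permCount p n : ℂ)) := by
  ext n
  rw [coeff_X_mul_derivative, coeff_mk, coeff_mul, Finset.Nat.sum_antidiagonal_eq_sum_range_succ_mk]
  have h2 := congrArg (Nat.cast (R := ℂ)) (mul_permCount_eq_sum p n)
  push_cast at h2
  rw [h2]
  simp [series]

/-- The logarithmic derivative formula for the series of all pairs of permutations, rewritten in
terms of the hypergeometric series by the chain rule. -/
theorem series_eq (hp : 2 ≤ p) (f x : PowerSeries ℂ)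
    (hf : f = hypergeometricPowerSeries (fun i : Fin p => ((i : ℕ) + 1 : ℂ) / (p : ℂ))
        (Fin.elim0 : Fin 0 → ℂ))
    (hx : x = C ((p : ℂ) ^ (p - 1)) * X ^ p) :
    series p = C (p : ℂ) * x * PowerSeries.subst x (PowerSeries.derivative ℂ f) *
          (PowerSeries.subst x f)⁻¹ := by
  have hF : PowerSeries.subst x f = PowerSeries.mk fun n => (permCount p n : ℂ) := by
    rw [hf, hx, subst_hypergeometricPowerSeries hp]
  have hs : HasSubst x := HasSubst.of_constantCoeff_zero' (by
    rw [hx]; simp [show p ≠ 0 by omega])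
  have h0 : constantCoeff (PowerSeries.subst x f) ≠ 0 := by
    have h := permCount_mul hp 0
    simp only [mul_zero, pow_zero, Nat.factorial_zero, mul_one] at h
    rw [hF, ← coeff_zero_eq_constantCoeff_apply, coeff_mk, h]
    simp
  have hd : X * PowerSeries.derivative ℂ x = C (p : ℂ) * x := by
    ext n
    rw [coeff_X_mul_derivative, coeff_C_mul, hx, coeff_C_mul, coeff_X_pow]
    split_ifs with h
    · rw [h]
    · simp
  rw [PowerSeries.eq_mul_inv_iff_mul_eq h0, hF, series_mul_mk_permCount, ← hF,
    PowerSeries.derivative_subst hs, ← hd]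
  ring

end RootedHypermap

/-! ### Most pairs of permutations are connected -/

theorem Nat.add_le_add_choose {j m : ℕ} (hj : 1 ≤ j) (hm : 1 ≤ m) :
    j + m ≤ (j + m).choose j := by
  induction m, hm using Nat.le_induction with
  | base => simp
  | succ m hm ih =>
    obtain ⟨i, rfl⟩ : ∃ i, j = i + 1 := ⟨j - 1, by omega⟩
    rw [← add_assoc, Nat.choose_succ_succ']
    have : 0 < (i + 1 + m).choose i := Nat.choose_pos (by omega)
    omega

theorem Nat.choose_two_le_add_choose {j m : ℕ} (hj : 2 ≤ j) (hm : 2 ≤ m) :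
    (j + m).choose 2 ≤ (j + m).choose j := by
  induction m, hm using Nat.le_induction with
  | base => rw [Nat.choose_symm_add]
  | succ m hm ih =>
    obtain ⟨i, rfl⟩ : ∃ i, j = i + 1 := ⟨j - 1, by omega⟩
    rw [← add_assoc, Nat.choose_succ_succ', Nat.choose_succ_succ', Nat.choose_one_right]
    have h := Nat.add_le_add_choose (j := i) (m := m + 1) (by omega) (by omega)
    rw [show i + (m + 1) = i + 1 + m by ring] at h
    have ih' : (i + 1 + m).choose (1 + 1) ≤ _ := ih
    omega

/-- A single term of the iterated Vandermonde convolution. -/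
theorem Nat.choose_pow_le_choose_mul (p k j : ℕ) : k.choose j ^ p ≤ (p * k).choose (p * j) := by
  induction p with
  | zero => simp
  | succ p ih =>
    rw [Nat.succ_mul, Nat.succ_mul, Nat.add_choose_eq, pow_succ]
    exact (Nat.mul_le_mul_right _ ih).trans (Finset.single_le_sum
      (f := fun ij : ℕ × ℕ => (p * k).choose ij.1 * k.choose ij.2) (fun _ _ => Nat.zero_le _)
      (a := (p * j, j)) (Finset.HasAntidiagonal.mem_antidiagonal.2 rfl))

/-- The terms `j = 1` and `j = k - 1` contribute `1 / k` each, and each of the others is at most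
`1 / k.choose 2`. -/
theorem sum_inv_choose_le {k : ℕ} (hk : 2 ≤ k) :
    ∑ j ∈ Finset.Ico 1 k, ((k.choose j : ℕ) : ℝ)⁻¹ ≤ 4 / ((k : ℝ) - 1) := by
  have hk' : (2 : ℝ) ≤ k := by exact_mod_cast hk
  have hk1 : (0 : ℝ) < (k : ℝ) - 1 := by linarith
  have hk0 : (0 : ℝ) < k := by linarith
  have hterm : ∀ j ∈ Finset.Ico 1 k, ((k.choose j : ℕ) : ℝ)⁻¹ ≤
      (if j = 1 then (k : ℝ)⁻¹ else 0) + (if j = k - 1 then (k : ℝ)⁻¹ else 0) +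
        2 / ((k : ℝ) * ((k : ℝ) - 1)) := by
    intro j hj
    rw [Finset.mem_Ico] at hj
    obtain ⟨m, rfl⟩ : ∃ m, k = j + m := ⟨k - j, by omega⟩
    have hnn : (0 : ℝ) ≤ 2 / (((j + m : ℕ) : ℝ) * (((j + m : ℕ) : ℝ) - 1)) := by positivity
    have hinv : (0 : ℝ) ≤ ((j + m : ℕ) : ℝ)⁻¹ := by positivity
    by_cases hend : j = 1 ∨ m = 1
    · have h1 : (((j + m).choose j : ℕ) : ℝ)⁻¹ ≤ ((j + m : ℕ) : ℝ)⁻¹ := by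
        apply inv_anti₀ hk0
        exact_mod_cast Nat.add_le_add_choose hj.1 (by omega)
      rcases hend with h | h
      · rw [if_pos h]
        split_ifs <;> linarith
      · rw [if_pos (show j = j + m - 1 by omega)]
        split_ifs <;> linarith
    · rw [if_neg (by omega), if_neg (by omega), zero_add, zero_add]
      have h2 : (((j + m).choose 2 : ℕ) : ℝ) ≤ (((j + m).choose j : ℕ) : ℝ) := by
        exact_mod_cast Nat.choose_two_le_add_choose (by omega) (by omega)
      rw [Nat.cast_choose_two] at h2
      have h3 := inv_anti₀ (by positivity) h2
      rwa [inv_div] at h3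
  refine (Finset.sum_le_sum hterm).trans ?_
  rw [Finset.sum_add_distrib, Finset.sum_add_distrib, Finset.sum_ite_eq', Finset.sum_ite_eq',
    Finset.sum_const, Nat.card_Ico, if_pos (Finset.mem_Ico.2 ⟨le_rfl, by omega⟩),
    if_pos (Finset.mem_Ico.2 ⟨by omega, by omega⟩), nsmul_eq_mul, Nat.cast_sub (by omega),
    Nat.cast_one]
  have h4 : (k : ℝ)⁻¹ ≤ ((k : ℝ) - 1)⁻¹ := inv_anti₀ hk1 (by linarith)
  have h5 : ((k : ℝ) - 1) * (2 / ((k : ℝ) * ((k : ℝ) - 1))) = 2 * (k : ℝ)⁻¹ := by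
    field_simp
  rw [h5, div_eq_mul_inv]
  linarith

namespace RootedHypermap

variable {p : ℕ}

theorem permCount_zero (hp : 2 ≤ p) : permCount p 0 = 1 := by
  simpa using permCount_mul hp 0

theorem permCount_mul_pos (hp : 2 ≤ p) (k : ℕ) : 0 < permCount p (p * k) := by
  refine Nat.pos_of_ne_zero fun h => (p * k).factorial_ne_zero ?_
  rw [← permCount_mul hp, h, zero_mul]

theorem mul_permCount_mul_eq_sum (hp : 2 ≤ p) (k : ℕ) :
    p * k * permCount p (p * k) =
      ∑ j ∈ Finset.range (k + 1), count p (p * j) * permCount p (p * (k - j)) := by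
  rw [mul_permCount_eq_sum]
  symm
  refine Finset.sum_of_injOn (p * ·) (fun _ _ _ _ h => Nat.eq_of_mul_eq_mul_left (by omega) h)
    (fun j hj => ?_) (fun m hm hmk => ?_) (fun j _ => by rw [Nat.mul_sub])
  · simp only [Finset.coe_range, Set.mem_Iio] at hj ⊢
    exact Nat.lt_succ_of_le (Nat.mul_le_mul_left p (Nat.lt_succ_iff.1 hj))
  · have : count p m = 0 := by
      by_contra h
      obtain ⟨-, j, rfl⟩ := (count_ne_zero_iff hp m).1 h
      refine hmk ⟨j, ?_, rfl⟩
      simp only [Finset.coe_range, Set.mem_Iio, Finset.mem_range, Nat.lt_succ_iff] at hm ⊢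
      exact Nat.le_of_mul_le_mul_left hm (by omega)
    rw [this, zero_mul]

theorem count_mul_le (hp : 2 ≤ p) (k : ℕ) :
    count p (p * k) ≤ p * k * permCount p (p * k) := by
  rw [mul_permCount_mul_eq_sum hp, Finset.sum_range_succ, Nat.sub_self, mul_zero,
    permCount_zero hp, mul_one]
  exact Nat.le_add_left _ _

/-- The binomial coefficients `k.choose j` and `(p * k).choose (p * j)` enter through the factorials
in `permCount_mul`, and the latter is at least the square of the former. -/
theorem choose_mul_permCount_le (hp : 2 ≤ p) {j k : ℕ} (hjk : j ≤ k) :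
    k.choose j * (permCount p (p * j) * permCount p (p * (k - j))) ≤ permCount p (p * k) := by
  obtain ⟨m, rfl⟩ := Nat.exists_eq_add_of_le hjk
  rw [Nat.add_sub_cancel_left]
  have h1 := permCount_mul hp (j + m)
  have h2 := permCount_mul hp j
  have h3 := permCount_mul hp m
  have h4 := Nat.add_choose_mul_factorial_mul_factorial j m
  have h5 := Nat.add_choose_mul_factorial_mul_factorial (p * j) (p * m)
  rw [← Nat.choose_symm_add] at h4 h5
  rw [← mul_add, ← h1, ← h2, ← h3, ← h4] at h5
  have h6 : (j + m).choose j ^ 2 ≤ (p * (j + m)).choose (p * j) :=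
    (Nat.pow_le_pow_right (Nat.choose_pos (by omega)) hp).trans
      (Nat.choose_pow_le_choose_mul p _ _)
  have hpos : 0 < p ^ (j + m) * (j.factorial * m.factorial) := by positivity
  have h7 : (p * (j + m)).choose (p * j) * (permCount p (p * j) * permCount p (p * m)) =
      permCount p (p * (j + m)) * (j + m).choose j := by
    apply Nat.eq_of_mul_eq_mul_right hpos
    rw [pow_add] at h5 ⊢
    linear_combination h5
  have hc : 0 < (j + m).choose j := Nat.choose_pos (by omega)
  apply Nat.le_of_mul_le_mul_right _ hc
  rw [← h7]
  calc _ = (j + m).choose j ^ 2 * (permCount p (p * j) * permCount p (p * m)) := by ring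
    _ ≤ _ := Nat.mul_le_mul_right _ h6

theorem factorial_le_permCount (hp : 2 ≤ p) (k : ℕ) : k.factorial ≤ permCount p (p * k) := by
  induction k with
  | zero => exact permCount_mul_pos hp 0
  | succ k ih =>
    have h := choose_mul_permCount_le hp (j := 1) (k := k + 1) (by omega)
    rw [Nat.choose_one_right, Nat.add_sub_cancel] at h
    refine le_trans ?_ h
    rw [Nat.factorial_succ]
    exact Nat.mul_le_mul_left _ (ih.trans (Nat.le_mul_of_pos_left _ (permCount_mul_pos hp 1)))

/-- The relative error made on ignoring the connectedness condition is `O(1 / k)`. -/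
theorem mul_permCount_sub_count_le (hp : 2 ≤ p) {k : ℕ} (hk : 2 ≤ k) :
    (p * k : ℝ) * permCount p (p * k) - count p (p * k) ≤
      4 / ((k : ℝ) - 1) * ((p * k : ℝ) * permCount p (p * k)) := by
  have h := congrArg (Nat.cast (R := ℝ)) (mul_permCount_mul_eq_sum hp k)
  rw [Finset.sum_range_succ, Nat.sub_self, mul_zero, permCount_zero hp, mul_one,
    Finset.range_eq_Ico, Finset.sum_eq_sum_Ico_succ_bot (by omega), mul_zero, count_zero,
    zero_mul, zero_add] at h
  push_cast at h
  rw [h, add_sub_cancel_right, ← h]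
  calc ∑ j ∈ Finset.Ico (0 + 1) k, (count p (p * j) : ℝ) * permCount p (p * (k - j))
      ≤ ∑ j ∈ Finset.Ico 1 k,
        ((k.choose j : ℕ) : ℝ)⁻¹ * ((p * k : ℝ) * permCount p (p * k)) := by
        refine Finset.sum_le_sum fun j hj => ?_
        rw [Finset.mem_Ico] at hj
        have hc : (0 : ℝ) < (k.choose j : ℕ) := by exact_mod_cast Nat.choose_pos (by omega)
        rw [inv_mul_eq_div, le_div_iff₀ hc]
        have h1 : (k.choose j : ℝ) * (permCount p (p * j) * permCount p (p * (k - j))) ≤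
          permCount p (p * k) := by exact_mod_cast choose_mul_permCount_le hp (by omega : j ≤ k)
        have h2 : (count p (p * j) : ℝ) ≤ p * k * permCount p (p * j) := by
          have h3 : (count p (p * j) : ℝ) ≤ p * j * permCount p (p * j) := by
            exact_mod_cast count_mul_le hp j
          refine h3.trans ?_
          have : (j : ℝ) ≤ k := by exact_mod_cast hj.2.le
          gcongr
        calc (count p (p * j) : ℝ) * permCount p (p * (k - j)) * (k.choose j : ℕ)
            ≤ (p * k * permCount p (p * j)) * permCount p (p * (k - j)) * (k.choose j : ℕ) := by
              gcongr
          _ = p * k * ((k.choose j : ℝ) *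
              (permCount p (p * j) * permCount p (p * (k - j)))) := by ring
          _ ≤ _ := by gcongr
    _ ≤ _ := by
      rw [← Finset.sum_mul]
      exact mul_le_mul_of_nonneg_right (sum_inv_choose_le hk) (by positivity)

end RootedHypermap

/-! ### Asymptotics and transcendence -/

section Growth

open Filter Topology Asymptotics

theorem ascPochhammer_eval_eq_prod_range {K : Type*} [CommRing K] (s : K) (n : ℕ) :
    (ascPochhammer K n).eval s = ∏ j ∈ Finset.range n, (s + j) := by
  induction n with
  | zero => simp
  | succ n ih => rw [ascPochhammer_succ_eval, ih, Finset.prod_range_succ]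

/-- Euler's limit formula for the Gamma function, as an asymptotic formula for `(s)ₙ`. -/
theorem ascPochhammer_eval_isEquivalent {s : ℝ} (hs : 0 < s) :
    (fun n : ℕ => (ascPochhammer ℝ n).eval s) ~[atTop]
      (fun n : ℕ => (n.factorial : ℝ) * (n : ℝ) ^ (s - 1) / Real.Gamma s) := by
  have hΓ := (Real.Gamma_pos_of_pos hs).ne'
  have h1 : Real.GammaSeq s ~[atTop] fun _ => Real.Gamma s :=
    (isEquivalent_const_iff_tendsto hΓ).2 (Real.GammaSeq_tendsto_Gamma s)
  have h2 : (fun n : ℕ => (n : ℝ) + s) ~[atTop] fun n : ℕ => (n : ℝ) := by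
    apply IsEquivalent.add_const_of_norm_tendsto_atTop IsEquivalent.refl
    exact tendsto_norm_atTop_atTop.comp tendsto_natCast_atTop_atTop
  have h3 : (fun n : ℕ => (n.factorial : ℝ) * (n : ℝ) ^ s) ~[atTop]
      fun n : ℕ => (n.factorial : ℝ) * (n : ℝ) ^ s := IsEquivalent.refl
  have h4 := h3.div (h1.mul h2)
  refine (IsEquivalent.congr_left h4 ?_).congr_right ?_
  · filter_upwards [eventually_gt_atTop 0] with n hn
    have hn' : (0 : ℝ) < n := by exact_mod_cast hn
    simp only [Pi.div_apply, Pi.mul_apply, Real.GammaSeq]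
    rw [Finset.prod_range_succ, ascPochhammer_eval_eq_prod_range]
    have hprod : 0 < ∏ j ∈ Finset.range n, (s + (j : ℝ)) :=
      Finset.prod_pos fun j _ => by positivity
    have : (0 : ℝ) < (n : ℝ) ^ s := Real.rpow_pos_of_pos hn' s
    field_simp
    ring
  · filter_upwards [eventually_gt_atTop 0] with n hn
    have hn' : (0 : ℝ) < n := by exact_mod_cast hn
    simp only [Pi.div_apply, Pi.mul_apply]
    rw [Real.rpow_sub_one hn'.ne']
    field_simp

theorem Finset.prod_Icc_one_eq_prod_range {K : Type*} [CommMonoid K] (f : ℕ → K) (n : ℕ) :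
    ∏ i ∈ Finset.Icc 1 n, f i = ∏ i ∈ Finset.range n, f (i + 1) := by
  rw [Finset.range_eq_Ico, Finset.prod_Ico_add' f 0 n 1]
  rfl

theorem sum_succ_div_sub_one {p : ℕ} (hp : p ≠ 0) :
    ∑ i ∈ Finset.range p, (((i : ℕ) + 1 : ℝ) / (p : ℝ) - 1) = (1 - (p : ℝ)) / 2 := by
  have hp' : (p : ℝ) ≠ 0 := Nat.cast_ne_zero.2 hp
  have h : ∀ n : ℕ, ∑ i ∈ Finset.range n, ((i : ℝ) + 1) = n * (n + 1) / 2 := by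
    intro n
    induction n with
    | zero => simp
    | succ n ih => rw [Finset.sum_range_succ, ih]; push_cast; ring
  rw [Finset.sum_sub_distrib, ← Finset.sum_div, h, Finset.sum_const, Finset.card_range, nsmul_one]
  field_simp
  ring

namespace RootedHypermap

variable {p : ℕ}

/-- Asymptotically, all pairs of permutations are connected; the factor `p * k` counts the choices
of the root. -/
theorem count_isEquivalent_mul_permCount (hp : 2 ≤ p) :
    (fun k : ℕ => (count p (p * k) : ℝ)) ~[atTop]
      fun k : ℕ => (p * k : ℝ) * permCount p (p * k) := by
  have hlim : Tendsto (fun k : ℕ => 4 / ((k : ℝ) - 1)) atTop (𝓝 0) :=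
    (tendsto_atTop_add_const_right _ (-1) tendsto_natCast_atTop_atTop).const_div_atTop 4
  refine IsLittleO.of_bound fun ε hε => ?_
  filter_upwards [hlim.eventually (gt_mem_nhds hε), eventually_ge_atTop 2] with k hk hk2
  have h1 := mul_permCount_sub_count_le hp hk2
  have h2 : (count p (p * k) : ℝ) ≤ (p * k : ℝ) * permCount p (p * k) := by
    exact_mod_cast count_mul_le hp k
  have h3 : (0 : ℝ) ≤ (p * k : ℝ) * permCount p (p * k) := by positivity
  rw [Pi.sub_apply, Real.norm_of_nonpos (by linarith), Real.norm_of_nonneg h3, neg_sub]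
  exact h1.trans (mul_le_mul_of_nonneg_right hk.le h3)

/-- The Gamma values come from Euler's limit formula for the `p` rising factorials, and the rest
from Stirling's formula for `k! ^ (p - 1)`. -/
theorem mul_permCount_isEquivalent (hp : 2 ≤ p) :
    (fun k : ℕ => (p * k : ℝ) * permCount p (p * k)) ~[atTop]
      (fun k : ℕ =>
        (2 * Real.pi) ^ (((p : ℝ) - 1) / 2) * (p : ℝ) /
            (∏ i ∈ Finset.Icc 1 p, Real.Gamma ((i : ℝ) / (p : ℝ))) *
          (k : ℝ) ^ (((p : ℝ) - 1) * (k : ℝ) + 1) *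
          Real.exp (((p : ℝ) - 1) * (Real.log (p : ℝ) - 1) * (k : ℝ))) := by
  obtain ⟨q, rfl⟩ : ∃ q, p = q + 1 := ⟨p - 1, by omega⟩
  have hasc : (fun k : ℕ => ∏ i ∈ Finset.range (q + 1),
      (ascPochhammer ℝ k).eval (((i : ℕ) + 1 : ℝ) / ((q + 1 : ℕ) : ℝ))) ~[atTop]
      fun k : ℕ => ∏ i ∈ Finset.range (q + 1), ((k.factorial : ℝ) *
        (k : ℝ) ^ (((i : ℕ) + 1 : ℝ) / ((q + 1 : ℕ) : ℝ) - 1) /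
          Real.Gamma (((i : ℕ) + 1 : ℝ) / ((q + 1 : ℕ) : ℝ))) := by
    have h := IsEquivalent.finsetProd (l := (atTop : Filter ℕ)) (s := Finset.range (q + 1))
      (f := fun i k => (ascPochhammer ℝ k).eval (((i : ℕ) + 1 : ℝ) / ((q + 1 : ℕ) : ℝ)))
      (fun i _ => ascPochhammer_eval_isEquivalent
        (s := ((i : ℕ) + 1 : ℝ) / ((q + 1 : ℕ) : ℝ)) (by positivity))
    simpa only [Finset.prod_fn] using h
  have hst := Stirling.factorial_isEquivalent_stirling.pow q
  -- `p * k * p ^ ((p - 1) * k) / ∏ Γ * k ^ ((1 - p) / 2)`, the factors other than `k! ^ (p - 1)`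
  have hrest : (fun k : ℕ => (((q + 1 : ℕ) : ℝ) * k) * (((q + 1 : ℕ) : ℝ) ^ q) ^ k *
      (k : ℝ) ^ ((1 - ((q + 1 : ℕ) : ℝ)) / 2) / ∏ i ∈ Finset.range (q + 1),
        Real.Gamma (((i : ℕ) + 1 : ℝ) / ((q + 1 : ℕ) : ℝ))) ~[atTop] _ := IsEquivalent.refl
  have hpre : (fun k : ℕ => (((q + 1 : ℕ) : ℝ) * k) * (((q + 1 : ℕ) : ℝ) ^ q) ^ k /
      (k.factorial : ℝ)) ~[atTop] _ := IsEquivalent.refl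
  refine IsEquivalent.trans (IsEquivalent.congr_left (hpre.mul hasc) ?_)
    (IsEquivalent.trans (IsEquivalent.congr_left (hrest.mul hst) ?_) ?_)
  · filter_upwards with k
    simp only [Pi.mul_apply]
    rw [← prod_ascPochhammer_eval_div_factorial (K := ℝ) hp k, Nat.add_sub_cancel]
    ring
  · filter_upwards [eventually_gt_atTop 0] with k hk
    have hk' : (0 : ℝ) < k := by exact_mod_cast hk
    have hf : (0 : ℝ) < k.factorial := by positivity
    simp only [Pi.mul_apply, Pi.pow_apply]
    rw [Finset.prod_div_distrib, Finset.prod_mul_distrib, Finset.prod_const, Finset.card_range,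
      ← Real.rpow_sum_of_pos hk', sum_succ_div_sub_one (by omega), pow_succ]
    field_simp
  · refine IsEquivalent.congr_right IsEquivalent.refl ?_
    filter_upwards [eventually_gt_atTop 0] with k hk
    have hk' : (0 : ℝ) < k := by exact_mod_cast hk
    simp only [Pi.mul_apply, Pi.pow_apply]
    rw [Finset.prod_Icc_one_eq_prod_range
      (fun i => Real.Gamma ((i : ℝ) / ((q + 1 : ℕ) : ℝ))) (q + 1)]
    simp only [Nat.cast_add, Nat.cast_one, add_sub_cancel_right]
    have e1 : √(2 * k * Real.pi) ^ q =
        (2 * Real.pi) ^ ((q : ℝ) / 2) * (k : ℝ) ^ ((q : ℝ) / 2) := by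
      rw [← Real.mul_rpow (by positivity) hk'.le, Real.sqrt_eq_rpow, ← Real.rpow_natCast,
        ← Real.rpow_mul (by positivity)]
      congr 1 <;> ring
    have e2 : ((k / Real.exp 1) ^ k) ^ q = (k : ℝ) ^ ((q : ℝ) * k) * Real.exp (-(q * k : ℝ)) := by
      rw [div_pow, div_pow, ← pow_mul, ← pow_mul, ← Real.rpow_natCast, Real.exp_neg,
        ← Real.exp_nat_mul, div_eq_mul_inv]
      push_cast
      congr 2 <;> ring_nf
    have e3 : (((q : ℝ) + 1) ^ q) ^ k = Real.exp (q * Real.log ((q : ℝ) + 1) * k) := by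
      rw [← pow_mul, ← Real.rpow_natCast, Real.rpow_def_of_pos (by positivity)]
      push_cast
      ring_nf
    have e4 : (k : ℝ) ^ ((1 - ((q : ℝ) + 1)) / 2) * (k : ℝ) ^ ((q : ℝ) / 2) = 1 := by
      rw [← Real.rpow_add hk', show (1 - ((q : ℝ) + 1)) / 2 + (q : ℝ) / 2 = 0 by ring,
        Real.rpow_zero]
    have e5 : Real.exp ((q : ℝ) * (Real.log ((q : ℝ) + 1) - 1) * k) =
        Real.exp (q * Real.log ((q : ℝ) + 1) * k) * Real.exp (-(q * k : ℝ)) := by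
      rw [← Real.exp_add]; ring_nf
    rw [mul_pow, e1, e2, e3, e5, Real.rpow_add_one hk'.ne']
    set G := ∏ i ∈ Finset.range (q + 1), Real.Gamma (((i : ℝ) + 1) / ((q : ℝ) + 1))
    linear_combination (((q : ℝ) + 1) * k * Real.exp (q * Real.log ((q : ℝ) + 1) * k) / G *
      (2 * Real.pi) ^ ((q : ℝ) / 2) * (k : ℝ) ^ ((q : ℝ) * k) * Real.exp (-(q * k : ℝ))) * e4

/-- The coefficient of `z ^ (p * k)` is at least `k!` for `k ≥ 9`, so the radius of convergence is
zero. -/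
theorem transcendental_series (hp : 2 ≤ p) : Transcendental (Polynomial ℂ) (series p) := by
  intro halg
  obtain ⟨r, hr, B, hB⟩ := PowerSeries.exists_norm_coeff_mul_pow_le_of_isAlgebraic halg
  have hρ : 0 < r ^ p := pow_pos hr p
  have hB' : 0 < |B| + 1 := by positivity
  have h1 := (FloorSemiring.tendsto_pow_div_factorial_atTop (r ^ p)⁻¹).eventually
    (gt_mem_nhds (inv_pos.2 hB'))
  obtain ⟨k, hk, hk9⟩ := (h1.and (eventually_ge_atTop 9)).exists
  have hk9' : (9 : ℝ) ≤ k := by exact_mod_cast hk9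
  have hp2 : (2 : ℝ) ≤ p := by exact_mod_cast hp
  have h2 := mul_permCount_sub_count_le hp (k := k) (by omega)
  have h3 : (k.factorial : ℝ) ≤ permCount p (p * k) := by
    exact_mod_cast factorial_le_permCount hp k
  have h4 : 4 / ((k : ℝ) - 1) ≤ 1 / 2 := by
    rw [div_le_div_iff₀ (by linarith) (by norm_num)]; linarith
  have h5 : (2 : ℝ) * permCount p (p * k) ≤ (p * k : ℝ) * permCount p (p * k) := by
    refine mul_le_mul_of_nonneg_right ?_ (by positivity)
    nlinarith
  have h6 : 4 / ((k : ℝ) - 1) * ((p * k : ℝ) * permCount p (p * k)) ≤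
      1 / 2 * ((p * k : ℝ) * permCount p (p * k)) :=
    mul_le_mul_of_nonneg_right h4 (by positivity)
  have h7 : (k.factorial : ℝ) ≤ count p (p * k) := by linarith
  have h8 := hB (p * k)
  rw [series, PowerSeries.coeff_mk, Complex.norm_natCast, pow_mul] at h8
  have hf : (0 : ℝ) < k.factorial := by positivity
  have hρk : 0 < (r ^ p) ^ k := pow_pos hρ k
  rw [inv_pow, div_lt_iff₀ hf, inv_mul_eq_div, lt_div_iff₀ hB', inv_mul_lt_iff₀ hρk] at hk
  have h9 : (r ^ p) ^ k * k.factorial ≤ count p (p * k) * (r ^ p) ^ k := by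
    rw [mul_comm]; exact mul_le_mul_of_nonneg_right h7 hρk.le
  linarith [le_abs_self B]

end RootedHypermap

end Growth

theorem mainTheorem9 (p : ℕ) (hp : 2 ≤ p) :
    -- the generating series is transcendental over the polynomials
    Transcendental (Polynomial ℂ) (RootedHypermap.series p) ∧
    -- the generating series is `p x f'(x) / f(x)` at `x = p ^ (p - 1) * z ^ p`
    (let f : PowerSeries ℂ :=
        hypergeometricPowerSeries (fun i : Fin p => ((i : ℕ) + 1 : ℂ) / (p : ℂ))
          (Fin.elim0 : Fin 0 → ℂ)
      let x : PowerSeries ℂ := PowerSeries.C ((p : ℂ) ^ (p - 1)) * PowerSeries.X ^ p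
      RootedHypermap.series p =
        PowerSeries.C (p : ℂ) * x * PowerSeries.subst x (PowerSeries.derivative ℂ f) *
          (PowerSeries.subst x f)⁻¹) ∧
    -- the non-zero coefficients are those at positive multiples of `p`
    (∀ n : ℕ, RootedHypermap.count p n ≠ 0 ↔ n ≠ 0 ∧ p ∣ n) ∧
    -- their asymptotics
    (fun k : ℕ => (RootedHypermap.count p (p * k) : ℝ)) ~[Filter.atTop]
      (fun k : ℕ =>
        (2 * Real.pi) ^ (((p : ℝ) - 1) / 2) * (p : ℝ) /
            (∏ i ∈ Finset.Icc 1 p, Real.Gamma ((i : ℝ) / (p : ℝ))) *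
          (k : ℝ) ^ (((p : ℝ) - 1) * (k : ℝ) + 1) *
          Real.exp (((p : ℝ) - 1) * (Real.log (p : ℝ) - 1) * (k : ℝ))) := by
  exact ⟨RootedHypermap.transcendental_series hp, RootedHypermap.series_eq hp _ _ rfl rfl,
    RootedHypermap.count_ne_zero_iff hp,
    (RootedHypermap.count_isEquivalent_mul_permCount hp).trans
      (RootedHypermap.mul_permCount_isEquivalent hp)⟩
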